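/- Let $p$ be a prime and let $a\ge 1$ be an integer. For $m\ge 1$, $n\ge 0$ and $r\in\mathbb Z$ put $$C_m(n,r)=\sum_{\substack{0\le k\le n\\ k\equiv r\ (\mathrm{mod}\ m)}}\binom nk(-1)^k,$$ and define the generalized Fleck quotient, for integers $n\ge 0$ and $r$, by $$F_{p^a}(n,r)=(-p)^{-\lfloor (n-p^{a-1})/\varphi(p^a)\rfloor}\,C_{p^a}(n,r)+[\![n<p^{a-1}]\!],$$ where $\varphi$ is Euler's totient function and $[\![A]\!]$ is $1$ if $A$ holds and $0$ otherwise. All these numbers $F_{p^a}(n,r)$ are integers. For $x\in\mathbb Z$ and $k\ge 0$ write $\binom xk=x(x-1)\cdots(x-k+1)/k!$, and let $\mathrm{ord}_p$ denote the $p$-adic order. **Theorem 1.4.** Let $n\ge p^{a-1}$ be an integer. (i) For every $r\in\mathbb Z$, $$F_{p^a}(n,r)\equiv\sum_{k=0}^{d}\binom{r+k-1}{k}F_{p^a}(n+k,0)\pmod p,$$ where $d$ is the least nonnegative integer with $n+d\equiv p^{a-1}-1\pmod{\varphi(p^a)}$. (ii) There is an $r\in\mathbb Z$ with $C_{p^a}(n,r)\ne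 0$ and $$\mathrm{ord}_p\bigl(C_{p^a}(n,r)\bigr)=\left\lfloor\frac{n-p^{a-1}}{\varphi(p^a)}\right\rfloor,$$ that is, with $p\nmid F_{p^a}(n,r)$. Moreover, if $n\ge 2p^{a-1}$, then for all $r\in\mathbb Z$, $$F_{p^a}\bigl(n+p^a(p-1),r\bigr)\equiv F_{p^a}(n,r)\pmod p.$$ -/

import Mathlib

/-- The alternating binomial sum `C_m(n, r) = ∑_{k ≡ r (mod m)} (-1)^k (n choose k)`,
where `k` runs over `0, …, n`. -/
def altBinomSum (m n : ℕ) (r : ℤ) : ℤ :=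
  ∑ k ∈ (Finset.range (n + 1)).filter (fun k : ℕ => (k : ℤ) ≡ r [ZMOD (m : ℤ)]),
    (n.choose k : ℤ) * (-1) ^ k

/-- The exponent `⌊(n - p^(a-1)) / φ(p^a)⌋` (with true subtraction and division; it is negative
for `n < p^(a-1)`), for `a ≥ 1`. -/
def weismanExponent (p a n : ℕ) : ℤ :=
  ⌊((n : ℚ) - (p : ℚ) ^ (a - 1)) / ((p ^ a).totient : ℚ)⌋

/-- The generalized Fleck quotient
`F_{p^a}(n, r) = (-p)^(-⌊(n - p^(a-1)) / φ(p^a)⌋) C_{p^a}(n, r) + ⟦n < p^(a-1)⟧`, for `a ≥ 1`,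
as a rational number; that it is an integer is part of the theorem. -/
def fleckQuotient (p a n : ℕ) (r : ℤ) : ℚ :=
  (-(p : ℚ)) ^ (-weismanExponent p a n) * (altBinomSum (p ^ a) n r : ℚ)
    + (if n < p ^ (a - 1) then 1 else 0)

/-- `d = {p^(a-1) - 1 - n}_{φ(p^a)}`, the least nonnegative residue (computed in `ℤ`), that is, the
least `d ≥ 0` with `n + d ≡ p^(a-1) - 1 (mod φ(p^a))`. -/
def fleckShift (p a n : ℕ) : ℕ :=
  (((p : ℤ) ^ (a - 1) - 1 - (n : ℤ)) % ((p ^ a).totient : ℤ)).toNat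

/-!
Write `a = b + 1`, `φ = p ^ b * (p - 1)` and `Φ = ∑ i < p, x ^ (i * p ^ b)`. The sum
`C_{p^a}(n, r)` is the coefficient of `r` in `(1 - x) ^ n`, where `x` is the generator of the group
algebra `ℤ[ℤ/p^a]`; so all claims concern the powers of `1 - x` in a commutative ring in which
`x ^ p ^ a = 1` and `p` is cancellable.

Everything rests on the identity `(1 - x) ^ φ = Φ - p * g` with
`g = 1 + (1 - x) ^ c * s + p * t`, `c ≥ 1` and `c * p ≥ φ` (`exists_one_sub_pow_totient`). Since
`Φ * (x ^ p ^ b - 1) = 0`, multiples of `Φ` behave as they would one level lower, where powers of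
`1 - x` are more divisible by `p`. This gives Weisman's divisibility by induction on the level
(`prime_pow_dvd_mul_one_sub_pow`), hence quotients
`G n = (1 - x) ^ n / (-p) ^ ⌊(n - p ^ b) / φ⌋`, and it makes the contribution of `Φ` negligible in
`G (n + φ) ≡ g * G n (mod p)` (`quotient_add_totient`).

If `n + 1 ≡ p ^ b (mod φ)`, then `G n ≡ ∑ i < p ^ a, x ^ i (mod p)`: this holds for `n = p ^ a - 1`,
and `g` fixes the right side because `1 - x` kills it. So all Fleck quotients at such an `n` are
`≡ 1`. For other `n` the exponent does not change from `n` to `n + 1`, so the quotients satisfy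
`F (n + 1) r = F n r - F n (r - 1)`; descending from the next `n` of the special kind gives (i) and
the existence of an `r` with `p ∤ F n r`. For the periodicity, `p` steps of length `φ` multiply
`G n` by `g ^ p ≡ 1 + (1 - x) ^ (c * p) * s ^ p`, and `(1 - x) ^ φ * G n = -p * G (n + φ)`.
-/

/-! ### Powers of `1 - x` and the cyclotomic sum -/

theorem exists_one_sub_pow_prime_pow_sub_one {p : ℕ} (hp : p.Prime) (k : ℕ) :
    ∃ u : Polynomial ℤ, (1 - Polynomial.X) ^ (p ^ k - 1)
      = ∑ i ∈ Finset.range (p ^ k), Polynomial.X ^ i + (p : Polynomial ℤ) * u := by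
  have : Fact p.Prime := ⟨hp⟩
  have hz : (1 - Polynomial.X : Polynomial (ZMod p)) ^ (p ^ k - 1)
      = ∑ i ∈ Finset.range (p ^ k), Polynomial.X ^ i := by
    have h1 : (1 - Polynomial.X : Polynomial (ZMod p)) ≠ 0 := by
      intro h
      have := congrArg (Polynomial.eval 0) h
      simp at this
    apply mul_left_cancel₀ h1
    rw [← pow_succ', Nat.sub_add_cancel (Nat.one_le_pow _ _ hp.pos), mul_neg_geom_sum,
      sub_pow_char_pow, one_pow]
  have hd : (Polynomial.C (p : ℤ)) ∣ (1 - Polynomial.X : Polynomial ℤ) ^ (p ^ k - 1)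
      - ∑ i ∈ Finset.range (p ^ k), Polynomial.X ^ i := by
    rw [Polynomial.C_dvd_iff_dvd_coeff]
    intro i
    rw [← ZMod.intCast_zmod_eq_zero_iff_dvd _ p, ← eq_intCast (Int.castRingHom (ZMod p)),
      ← Polynomial.coeff_map]
    simp [Polynomial.map_sum, hz]
  obtain ⟨u, hu⟩ := hd
  exact ⟨u, by rw [← sub_eq_iff_eq_add', hu]; simp⟩

/-- The case `b = 0` of `exists_one_sub_pow_totient`, as an identity of polynomials. -/
theorem exists_one_sub_pow_prime_sub_one {p : ℕ} (hp : p.Prime) :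
    ∃ v : Polynomial ℤ, (1 - Polynomial.X) ^ (p - 1)
      = ∑ i ∈ Finset.range p, Polynomial.X ^ i
        - (p : Polynomial ℤ) * (1 + (1 - Polynomial.X) * v) := by
  obtain ⟨u, hu⟩ := exists_one_sub_pow_prime_pow_sub_one hp 1
  rw [pow_one] at hu
  -- At `X = 1` the identity reads `0 = p + p * u(1)`.
  have h1 : Polynomial.eval 1 u = -1 := by
    have := congrArg (Polynomial.eval 1) hu
    have h0 : p - 1 ≠ 0 := (Nat.sub_pos_of_lt hp.one_lt).ne'
    have hp0 : (p : ℤ) ≠ 0 := by exact_mod_cast hp.ne_zero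
    simp [Polynomial.eval_finsetSum, h0] at this
    apply mul_left_cancel₀ hp0
    linarith
  obtain ⟨v, hv⟩ := Polynomial.X_sub_C_dvd_sub_C_eval (a := 1) (p := u)
  refine ⟨v, ?_⟩
  rw [hu, eq_add_of_sub_eq hv, h1]
  simp
  ring

/-- Modulo `p`, the correction `g = 1 + (1 - x) ^ c * s + p * t` in `(1 - x) ^ φ = Φ - p * g`,
`φ = p ^ b * (p - 1)`, agrees with `1` to an order `c` in `1 - x` that is positive and at least
`φ / p`. For odd `p` one may take `c = p ^ b`; for `p = 2` and `b ≥ 1` only `c = 2 ^ (b - 1)` is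
obtained, as then `g ≡ x ^ 2 ^ (b - 1)`. -/
theorem exists_one_sub_pow_totient {R : Type*} [CommRing R] (x : R) {p : ℕ} (hp : p.Prime)
    (b : ℕ) :
    ∃ (c : ℕ) (s t : R), 1 ≤ c ∧ p ^ b * (p - 1) ≤ c * p ∧
      (1 - x) ^ (p ^ b * (p - 1)) = ∑ i ∈ Finset.range p, (x ^ p ^ b) ^ i
        - (p : R) * (1 + (1 - x) ^ c * s + (p : R) * t) := by
  rcases hp.eq_two_or_odd' with rfl | hodd
  · rcases b with _ | b
    · exact ⟨1, -1, 0, le_rfl, by norm_num, by simp [Finset.sum_range_succ]; ring⟩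
    · obtain ⟨k, hk⟩ : ∃ k, (1 - x) ^ 2 ^ b = 1 - x ^ 2 ^ b + 2 * k := by
        obtain ⟨r, hr⟩ := exists_add_pow_prime_pow_eq Nat.prime_two 1 (-x) b
        -- For `b = 0` the exponent `2 ^ b` is odd, so the sign of `(-x) ^ 2 ^ b` differs.
        rcases b with _ | b
        · exact ⟨0, by simp⟩
        · refine ⟨x ^ 2 ^ (b + 1) - x * r, ?_⟩
          rw [sub_eq_add_neg, hr, Even.neg_pow (by simp [pow_succ])]
          push_cast
          ring
      refine ⟨2 ^ b, -1, k - (k * (1 - x ^ 2 ^ b) + k ^ 2), Nat.one_le_two_pow, ?_, ?_⟩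
      · rw [pow_succ]; simp
      · have h2 : (1 - x) ^ (2 ^ (b + 1) * (2 - 1)) = ((1 - x) ^ 2 ^ b) ^ 2 := by
          rw [← pow_mul, pow_succ]; simp
        have h3 : x ^ 2 ^ (b + 1) = (x ^ 2 ^ b) ^ 2 := by rw [← pow_mul, pow_succ]
        rw [h2, h3, hk]
        simp [Finset.sum_range_succ]
        ring
  · obtain ⟨h, hh⟩ : ∃ h, (1 - x) ^ p ^ b = 1 - x ^ p ^ b + p * h := by
      obtain ⟨r, hr⟩ := exists_add_pow_prime_pow_eq hp 1 (-x) b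
      refine ⟨1 * -x * r, ?_⟩
      rw [sub_eq_add_neg, hr, (hodd.pow).neg_pow]
      ring
    obtain ⟨v, hv⟩ := exists_one_sub_pow_prime_sub_one hp
    have hv' := congrArg (Polynomial.aeval (x ^ p ^ b)) hv
    simp only [map_pow, map_sub, map_one, Polynomial.aeval_X, map_sum, map_mul, map_natCast,
      map_add] at hv'
    -- With `A = 1 - x ^ p ^ b`, expand `(A + p * h) ^ (p - 1)` modulo `p ^ 2`; as `p ≥ 3`, the linear
    -- term is still a multiple of `A`.
    obtain ⟨w, hw⟩ := Polynomial.powAddExpansion (1 - x ^ p ^ b) ((p : R) * h) (p - 1)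
    obtain ⟨m, rfl⟩ : ∃ m, p = m + 3 := by
      have := hp.two_le
      obtain ⟨j, rfl⟩ := hodd
      exact ⟨2 * j - 2, by omega⟩
    simp only [show m + 3 - 1 = m + 2 from rfl, show m + 2 - 1 = m + 1 from rfl] at hv' hw ⊢
    set A := 1 - x ^ (m + 3) ^ b with hA
    set v' := Polynomial.aeval (x ^ (m + 3) ^ b) v
    set S := v' - (m + 2) * A ^ m * h with hS
    refine ⟨(m + 3) ^ b, S, -(h * S) - w * h ^ 2, Nat.one_le_pow _ _ hp.pos, ?_, ?_⟩
    · exact Nat.mul_le_mul_left _ (Nat.le_succ _)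
    · rw [pow_mul, hh, hw, hv', hS]
      push_cast
      ring

/-! ### Weisman's divisibility -/

theorem prime_pow_succ_eq_add {p : ℕ} (hp : p.Prime) (b : ℕ) :
    p ^ (b + 1) = p ^ b + p ^ b * (p - 1) := by
  obtain ⟨m, rfl⟩ := Nat.exists_eq_add_of_le' hp.one_le
  simp [pow_succ]
  ring

/-- The exponent `⌊(n - p ^ b) / (p ^ b * (p - 1))⌋` grows by at least one when the level drops from
`b + 1` to `b`, and by at least two once `n` is not too close to `p ^ (b + 1)`. -/
theorem weisman_index_succ_le {p : ℕ} (hp : p.Prime) (b n : ℕ) (hn : p ^ (b + 1) ≤ n) :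
    (n - p ^ (b + 1)) / (p ^ (b + 1) * (p - 1)) + 1 ≤ (n - p ^ b) / (p ^ b * (p - 1)) ∧
    (p ^ (b + 1) + p ^ b * (p - 1) ≤ n →
      (n - p ^ (b + 1)) / (p ^ (b + 1) * (p - 1)) + 2 ≤ (n - p ^ b) / (p ^ b * (p - 1))) := by
  have hw : 0 < p ^ b * (p - 1) := Nat.mul_pos (pow_pos hp.pos _) (Nat.sub_pos_of_lt hp.one_lt)
  have h1 := prime_pow_succ_eq_add hp b
  have h2 : n - p ^ b = (n - p ^ (b + 1)) + p ^ b * (p - 1) := by omega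
  have h3 : p ^ (b + 1) * (p - 1) = p ^ b * (p - 1) * p := by ring
  rw [h2, Nat.add_div_right _ hw, h3, ← Nat.div_div_eq_div_mul]
  generalize hm : (n - p ^ (b + 1)) / (p ^ b * (p - 1)) = m
  have h4 : m / p ≤ m / 2 := Nat.div_le_div_left hp.two_le (by norm_num)
  refine ⟨by omega, fun h => ?_⟩
  have h5 : 1 ≤ m := by
    rw [← hm, Nat.one_le_div_iff hw]
    omega
  omega

/-- Weisman's divisibility, in the form that passes to lower levels: if `y` is annihilated by
`x ^ p ^ (b + 1) - 1`, then `y * Φ` is annihilated by `x ^ p ^ b - 1`, where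
`Φ = ∑ i < p, x ^ (i * p ^ b)`. -/
theorem prime_pow_dvd_mul_one_sub_pow {R : Type*} [CommRing R] (x : R) {p : ℕ} (hp : p.Prime)
    (b : ℕ) : ∀ (y : R), y * (x ^ p ^ (b + 1) - 1) = 0 → ∀ n, p ^ b ≤ n →
      (p : R) ^ ((n - p ^ b) / (p ^ b * (p - 1))) ∣ y * (1 - x) ^ n := by
  -- At a fixed level, the claim follows from a sharper divisibility for the multiples of `Φ`.
  have step : ∀ (b : ℕ) (y : R), (∀ n, p ^ b ≤ n →
      (p : R) ^ ((n - p ^ b) / (p ^ b * (p - 1)) + 1) ∣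
        y * (∑ i ∈ Finset.range p, (x ^ p ^ b) ^ i) * (1 - x) ^ n) → ∀ n, p ^ b ≤ n →
      (p : R) ^ ((n - p ^ b) / (p ^ b * (p - 1))) ∣ y * (1 - x) ^ n := by
    intro b y H n
    have hw : 0 < p ^ b * (p - 1) :=
      Nat.mul_pos (pow_pos hp.pos _) (Nat.sub_pos_of_lt hp.one_lt)
    induction n using Nat.strong_induction_on with
    | _ n ih =>
      intro hn
      rcases lt_or_ge n (p ^ b + p ^ b * (p - 1)) with h | h
      · rw [Nat.div_eq_of_lt (by omega), pow_zero]
        exact one_dvd _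
      · obtain ⟨m, rfl⟩ := Nat.exists_eq_add_of_le' h
        have e1 : m + (p ^ b + p ^ b * (p - 1)) - p ^ b = (m + p ^ b - p ^ b) + p ^ b * (p - 1) := by
          omega
        rw [e1, Nat.add_div_right _ hw, ← add_assoc]
        obtain ⟨c, s, t, -, -, hg⟩ := exists_one_sub_pow_totient x hp b
        have h1 := H (m + p ^ b) (by omega)
        obtain ⟨z, hz⟩ := ih (m + p ^ b) (by omega) (by omega)
        rw [pow_add (1 - x) (m + p ^ b), hg, ← mul_assoc, mul_sub]
        refine dvd_sub ?_ ?_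
        · rw [mul_right_comm]
          exact h1
        · rw [hz, pow_succ]
          exact ⟨z * (1 + (1 - x) ^ c * s + (p : R) * t), by ring⟩
  induction b with
  | zero =>
    intro y hy
    refine step 0 y fun n hn => ?_
    obtain ⟨m, rfl⟩ := Nat.exists_eq_add_of_le' hn
    have h0 : y * (∑ i ∈ Finset.range p, (x ^ p ^ 0) ^ i) * (1 - x) ^ (m + p ^ 0) = 0 := by
      have := geom_sum_mul x p
      simp only [pow_zero, pow_one, zero_add] at hy ⊢
      linear_combination (-(1 - x) ^ m) * hy - y * (1 - x) ^ m * this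
    rw [h0]
    exact dvd_zero _
  | succ b ih =>
    intro y hy
    refine step (b + 1) y fun n hn => ?_
    refine (pow_dvd_pow _ (weisman_index_succ_le hp b n hn).1).trans (ih _ ?_ n ?_)
    · rw [mul_assoc, geom_sum_mul, ← pow_mul, ← pow_succ, hy]
    · exact (Nat.pow_le_pow_right hp.pos (Nat.le_succ b)).trans hn

/-- `Φ * (1 - x) ^ n` has two factors `p` more than Weisman's exponent: multiples of `Φ` obey the
bound of the level below (and vanish if `b = 0`). -/
theorem prime_pow_dvd_geom_sum_mul_one_sub_pow {R : Type*} [CommRing R] (x : R) {p : ℕ}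
    (hp : p.Prime) (b : ℕ) (hx : x ^ p ^ (b + 1) = 1) (n : ℕ) (hn : p ^ b ≤ n)
    (h : b = 0 ∨ p ^ b + p ^ (b - 1) * (p - 1) ≤ n) :
    (p : R) ^ ((n - p ^ b) / (p ^ b * (p - 1)) + 2) ∣
      (∑ i ∈ Finset.range p, (x ^ p ^ b) ^ i) * (1 - x) ^ n := by
  have hker : (∑ i ∈ Finset.range p, (x ^ p ^ b) ^ i) * (x ^ p ^ b - 1) = 0 := by
    rw [geom_sum_mul, ← pow_mul, ← pow_succ, hx, sub_self]
  rcases b with _ | b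
  · obtain ⟨m, rfl⟩ := Nat.exists_eq_add_of_le' hn
    have h0 : (∑ i ∈ Finset.range p, (x ^ p ^ 0) ^ i) * (1 - x) ^ (m + p ^ 0) = 0 := by
      simp only [pow_zero, pow_one] at hker ⊢
      linear_combination (-(1 - x) ^ m) * hker
    rw [h0]
    exact dvd_zero _
  · refine (pow_dvd_pow _ ((weisman_index_succ_le hp b n hn).2 (by simpa using h))).trans
      (prime_pow_dvd_mul_one_sub_pow x hp b _ hker n ?_)
    exact (Nat.pow_le_pow_right hp.pos (Nat.le_succ b)).trans hn

theorem IsLeftRegular.neg_pow_cancel {R : Type*} [CommRing R] {q : R} (hq : IsLeftRegular q)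
    (k : ℕ) {u v : R} (h : (-q) ^ k * u = (-q) ^ k * v) : u = v := by
  rw [neg_pow, mul_assoc, mul_assoc] at h
  have h2 := congrArg (fun z => (-1) ^ k * z) h
  simp only [← mul_assoc, ← pow_add, Even.neg_one_pow ⟨k, rfl⟩, one_mul] at h2
  exact hq.pow k h2

theorem weisman_index_add {p : ℕ} (hp : p.Prime) (b n : ℕ) (hn : p ^ b ≤ n) :
    (n + p ^ b * (p - 1) - p ^ b) / (p ^ b * (p - 1)) = (n - p ^ b) / (p ^ b * (p - 1)) + 1 := by
  rw [Nat.sub_add_comm hn,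
    Nat.add_div_right _ (Nat.mul_pos (pow_pos hp.pos _) (Nat.sub_pos_of_lt hp.one_lt))]

/-! ### The quotients of `(1 - x) ^ n` by powers of `-p` -/

section Quotient

variable {R : Type*} [CommRing R] {x : R} {p b : ℕ} {G : ℕ → R}

theorem quotient_add_totient (hp : p.Prime) (hreg : IsLeftRegular (p : R))
    (hx : x ^ p ^ (b + 1) = 1)
    (hG : ∀ n, p ^ b ≤ n → (1 - x) ^ n = (-(p : R)) ^ ((n - p ^ b) / (p ^ b * (p - 1))) * G n) :
    ∃ (c : ℕ) (s : R), 1 ≤ c ∧ p ^ b * (p - 1) ≤ c * p ∧ ∀ n, p ^ b ≤ n →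
      (b = 0 ∨ p ^ b + p ^ (b - 1) * (p - 1) ≤ n) →
      (p : R) ∣ G (n + p ^ b * (p - 1)) - (1 + (1 - x) ^ c * s) * G n := by
  obtain ⟨c, s, t, hc, hcp, hg⟩ := exists_one_sub_pow_totient x hp b
  refine ⟨c, s, hc, hcp, fun n hn h => ?_⟩
  obtain ⟨z, hz⟩ := prime_pow_dvd_geom_sum_mul_one_sub_pow x hp b hx n hn h
  have h1 := hG (n + p ^ b * (p - 1)) (by omega)
  rw [weisman_index_add hp b n hn, add_comm n, pow_add, hg, sub_mul, hz, hG n hn] at h1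
  set e := (n - p ^ b) / (p ^ b * (p - 1))
  have h2 : G (p ^ b * (p - 1) + n)
      = (1 + (1 - x) ^ c * s + p * t) * G n + (-1) ^ (e + 1) * p * z := by
    apply hreg.neg_pow_cancel (e + 1)
    rw [← h1]
    have h3 : (p : R) ^ (e + 2) = (-(p : R)) ^ (e + 1) * ((-1) ^ (e + 1) * p) := by
      rw [← mul_assoc, ← mul_pow]
      ring
    rw [h3]
    ring
  rw [add_comm n, h2]
  exact ⟨t * G n + (-1) ^ (e + 1) * z, by ring⟩

theorem prime_dvd_one_sub_pow_mul_quotient (hp : p.Prime) (hreg : IsLeftRegular (p : R))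
    (hG : ∀ n, p ^ b ≤ n → (1 - x) ^ n = (-(p : R)) ^ ((n - p ^ b) / (p ^ b * (p - 1))) * G n)
    (n : ℕ) (hn : p ^ b ≤ n) : (p : R) ∣ (1 - x) ^ (p ^ b * (p - 1)) * G n := by
  refine ⟨-G (n + p ^ b * (p - 1)), ?_⟩
  apply hreg.neg_pow_cancel ((n - p ^ b) / (p ^ b * (p - 1)))
  have h1 := hG (n + p ^ b * (p - 1)) (by omega)
  rw [weisman_index_add hp b n hn, pow_add, hG n hn] at h1
  linear_combination h1

/-- The quotients at the arguments `n` with `n + 1 ≡ p ^ b` modulo `p ^ b * (p - 1)`, which are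
those written here when `n ≥ p ^ b`, since `p ^ (b + 1) = p ^ b + p ^ b * (p - 1)`. -/
theorem quotient_last_modEq_geom_sum (hp : p.Prime) (hreg : IsLeftRegular (p : R))
    (hx : x ^ p ^ (b + 1) = 1)
    (hG : ∀ n, p ^ b ≤ n → (1 - x) ^ n = (-(p : R)) ^ ((n - p ^ b) / (p ^ b * (p - 1))) * G n)
    (j : ℕ) : (p : R) ∣ G (p ^ (b + 1) - 1 + j * (p ^ b * (p - 1)))
      - ∑ i ∈ Finset.range (p ^ (b + 1)), x ^ i := by
  have hw : 0 < p ^ b * (p - 1) := Nat.mul_pos (pow_pos hp.pos _) (Nat.sub_pos_of_lt hp.one_lt)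
  have hpow := prime_pow_succ_eq_add hp b
  have hb : 0 < p ^ b := pow_pos hp.pos _
  induction j with
  | zero =>
    obtain ⟨u, hu⟩ := exists_one_sub_pow_prime_pow_sub_one hp (b + 1)
    have hu' := congrArg (Polynomial.aeval x) hu
    simp only [map_pow, map_sub, map_one, Polynomial.aeval_X, map_sum, map_mul, map_natCast,
      map_add] at hu'
    have h1 := hG (p ^ (b + 1) - 1) (by omega)
    rw [Nat.div_eq_of_lt (by omega), pow_zero, one_mul] at h1
    rw [zero_mul, add_zero, ← h1, hu', add_sub_cancel_left]
    exact dvd_mul_right _ _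
  | succ j ih =>
    obtain ⟨c, s, hc, -, hs⟩ := quotient_add_totient hp hreg hx hG
    have h1 := hs (p ^ (b + 1) - 1 + j * (p ^ b * (p - 1))) (by omega) (by
      rcases b with _ | b
      · exact Or.inl rfl
      · right
        have h2 : p ^ (b + 1) * (p - 1) = p ^ b * (p - 1) * p := by ring
        have h3 := Nat.mul_le_mul_left (p ^ b * (p - 1)) hp.two_le
        have h4 : 0 < p ^ b * (p - 1) :=
          Nat.mul_pos (pow_pos hp.pos _) (Nat.sub_pos_of_lt hp.one_lt)
        rw [Nat.add_sub_cancel]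
        omega)
    -- Hence the geometric sum is fixed by the factor `1 + (1 - x) ^ c * s`.
    have h0 : (1 - x) * ∑ i ∈ Finset.range (p ^ (b + 1)), x ^ i = 0 := by
      rw [mul_neg_geom_sum, hx, sub_self]
    obtain ⟨d, rfl⟩ := Nat.exists_eq_add_of_le' hc
    have h5 := dvd_add h1 (ih.mul_left (1 + (1 - x) ^ (d + 1) * s))
    rw [show p ^ (b + 1) - 1 + (j + 1) * (p ^ b * (p - 1))
      = p ^ (b + 1) - 1 + j * (p ^ b * (p - 1)) + p ^ b * (p - 1) by ring]
    convert h5 using 1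
    linear_combination (1 - x) ^ d * s * h0

theorem quotient_add_period (hp : p.Prime) (hreg : IsLeftRegular (p : R))
    (hx : x ^ p ^ (b + 1) = 1)
    (hG : ∀ n, p ^ b ≤ n → (1 - x) ^ n = (-(p : R)) ^ ((n - p ^ b) / (p ^ b * (p - 1))) * G n)
    (n : ℕ) (hn : 2 * p ^ b ≤ n) : (p : R) ∣ G (n + p ^ (b + 1) * (p - 1)) - G n := by
  obtain ⟨c, s, hc, hcp, hs⟩ := quotient_add_totient hp hreg hx hG
  have hiter : ∀ k, (p : R) ∣ G (n + k * (p ^ b * (p - 1))) - (1 + (1 - x) ^ c * s) ^ k * G n := by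
    intro k
    induction k with
    | zero => simp
    | succ k ih =>
      have h1 := hs (n + k * (p ^ b * (p - 1))) (by omega) (by
        rcases b with _ | b
        · exact Or.inl rfl
        · right
          have := prime_pow_succ_eq_add hp b
          rw [Nat.add_sub_cancel]
          omega)
      have h5 := dvd_add h1 (ih.mul_left (1 + (1 - x) ^ c * s))
      rw [show n + (k + 1) * (p ^ b * (p - 1)) = n + k * (p ^ b * (p - 1)) + p ^ b * (p - 1) by ring]
      convert h5 using 1
      ring
  have h1 := hiter p
  obtain ⟨r, hr⟩ := exists_add_pow_prime_pow_eq hp 1 ((1 - x) ^ c * s) 1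
  obtain ⟨d, hd⟩ := Nat.exists_eq_add_of_le hcp
  obtain ⟨z, hz⟩ := prime_dvd_one_sub_pow_mul_quotient hp hreg hG n (by omega)
  rw [pow_one, one_pow, mul_pow, ← pow_mul, hd, pow_add] at hr
  rw [show p * (p ^ b * (p - 1)) = p ^ (b + 1) * (p - 1) by ring, hr] at h1
  have h2 : (p : R) ∣ (p : R) *
      (z * (1 - x) ^ d * s ^ p + 1 * ((1 - x) ^ c * s) * r * G n) := dvd_mul_right _ _
  convert dvd_add h1 h2 using 1
  linear_combination (1 - x) ^ d * s ^ p * hz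

end Quotient

/-! ### Coefficients in the group algebra -/

theorem altBinomSum_eq_coeff (m n : ℕ) (r : ℤ) :
    altBinomSum m n r
      = ((1 - AddMonoidAlgebra.single (1 : ZMod m) (1 : ℤ)) ^ n).coeff (r : ZMod m) := by
  rw [sub_eq_neg_add, add_pow, altBinomSum, AddMonoidAlgebra.coeff_sum, Finsupp.finsetSum_apply,
    Finset.sum_filter]
  refine Finset.sum_congr rfl fun k _ => ?_
  have h1 : (-AddMonoidAlgebra.single (1 : ZMod m) (1 : ℤ)) ^ k * 1 ^ (n - k)
      * (n.choose k : AddMonoidAlgebra ℤ (ZMod m))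
      = AddMonoidAlgebra.single (k : ZMod m) ((n.choose k : ℤ) * (-1) ^ k) := by
    rw [← AddMonoidAlgebra.single_neg, AddMonoidAlgebra.single_pow, one_pow, mul_one,
      AddMonoidAlgebra.natCast_def, AddMonoidAlgebra.single_mul_single]
    simp [mul_comm]
  rw [h1, AddMonoidAlgebra.coeff_single, Finsupp.single_apply]
  have h2 : ((k : ZMod m) = (r : ZMod m)) ↔ (k : ℤ) ≡ r [ZMOD (m : ℤ)] := by
    rw [← ZMod.intCast_eq_intCast_iff]
    simp
  simp only [h2]

theorem AddMonoidAlgebra.coeff_intCast_mul {M : Type*} [AddMonoid M] (z : ℤ)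
    (u : AddMonoidAlgebra ℤ M) (r : M) :
    ((z : AddMonoidAlgebra ℤ M) * u).coeff r = z * u.coeff r := by
  rw [AddMonoidAlgebra.intCast_def, AddMonoidAlgebra.coeff_single_zero_mul, Int.cast_id]

theorem AddMonoidAlgebra.coeff_natCast_mul {M : Type*} [AddMonoid M] (p : ℕ)
    (u : AddMonoidAlgebra ℤ M) (r : M) :
    ((p : AddMonoidAlgebra ℤ M) * u).coeff r = p * u.coeff r := by
  rw [← Int.cast_natCast, AddMonoidAlgebra.coeff_intCast_mul]

theorem AddMonoidAlgebra.isLeftRegular_natCast {M : Type*} [AddMonoid M] {p : ℕ} (hp : p ≠ 0) :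
    IsLeftRegular (p : AddMonoidAlgebra ℤ M) := by
  intro u v h
  ext r
  have h1 := congrArg (fun w : AddMonoidAlgebra ℤ M => w.coeff r) h
  simp only [AddMonoidAlgebra.coeff_natCast_mul] at h1
  exact mul_left_cancel₀ (by exact_mod_cast hp) h1

theorem AddMonoidAlgebra.natCast_dvd_coeff {M : Type*} [AddMonoid M] {p : ℕ}
    {u : AddMonoidAlgebra ℤ M} (h : (p : AddMonoidAlgebra ℤ M) ∣ u) (r : M) :
    (p : ℤ) ∣ u.coeff r := by
  obtain ⟨v, rfl⟩ := h
  rw [AddMonoidAlgebra.coeff_natCast_mul]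
  exact dvd_mul_right _ _

theorem coeff_geom_sum_single_one (m : ℕ) [NeZero m] (r : ZMod m) :
    (∑ i ∈ Finset.range m, AddMonoidAlgebra.single (1 : ZMod m) (1 : ℤ) ^ i).coeff r = 1 := by
  rw [AddMonoidAlgebra.coeff_sum, Finsupp.finsetSum_apply,
    Finset.sum_eq_single_of_mem r.val (Finset.mem_range.2 r.val_lt)]
  · simp [AddMonoidAlgebra.single_pow]
  · intro i hi hir
    simp only [AddMonoidAlgebra.single_pow, nsmul_eq_mul, mul_one, one_pow,
      AddMonoidAlgebra.coeff_single]
    refine Finsupp.single_eq_of_ne' fun h => hir ?_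
    rw [← h, ZMod.val_cast_of_lt (Finset.mem_range.1 hi)]

/-- The integers `F n r` with `C_{p^a}(n, r) = (-p) ^ ⌊(n - p ^ b) / φ⌋ * F n r`, for `a = b + 1` and
`n ≥ p ^ b`: they are `≡ 1` modulo `p` where `n + 1 ≡ p ^ b` modulo `φ`, and periodic for
`n ≥ 2 * p ^ b`. -/
theorem exists_fleck_quotient {p : ℕ} (hp : p.Prime) (b : ℕ) :
    ∃ F : ℕ → ℤ → ℤ,
      (∀ n, p ^ b ≤ n → ∀ r, altBinomSum (p ^ (b + 1)) n r
        = (-(p : ℤ)) ^ ((n - p ^ b) / (p ^ b * (p - 1))) * F n r) ∧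
      (∀ j r, (p : ℤ) ∣ F (p ^ (b + 1) - 1 + j * (p ^ b * (p - 1))) r - 1) ∧
      (∀ n, 2 * p ^ b ≤ n → ∀ r, (p : ℤ) ∣ F (n + p ^ (b + 1) * (p - 1)) r - F n r) := by
  have : NeZero (p ^ (b + 1)) := ⟨pow_ne_zero _ hp.ne_zero⟩
  set x := AddMonoidAlgebra.single (1 : ZMod (p ^ (b + 1))) (1 : ℤ) with hxdef
  have hx : x ^ p ^ (b + 1) = 1 := by
    rw [hxdef, AddMonoidAlgebra.single_pow, one_pow, nsmul_one, ZMod.natCast_self]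
    rfl
  have hreg := AddMonoidAlgebra.isLeftRegular_natCast (M := ZMod (p ^ (b + 1))) hp.ne_zero
  have hdvd : ∀ n, ∃ g, p ^ b ≤ n →
      (1 - x) ^ n = (-(p : AddMonoidAlgebra ℤ (ZMod (p ^ (b + 1))))) ^
        ((n - p ^ b) / (p ^ b * (p - 1))) * g := by
    intro n
    by_cases hn : p ^ b ≤ n
    · have h1 := prime_pow_dvd_mul_one_sub_pow x hp b 1 (by rw [hx, sub_self, mul_zero]) n hn
      rw [one_mul] at h1
      obtain ⟨g, hg⟩ := (pow_dvd_pow_of_dvd (neg_dvd.2 dvd_rfl) _).trans h1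
      exact ⟨g, fun _ => hg⟩
    · exact ⟨0, fun h => absurd h hn⟩
  choose G hG using hdvd
  refine ⟨fun n r => (G n).coeff r, ?_, ?_, ?_⟩
  · intro n hn r
    rw [altBinomSum_eq_coeff, ← hxdef, hG n hn]
    rw [← AddMonoidAlgebra.coeff_intCast_mul]
    push_cast
    rfl
  · intro j r
    have h1 := AddMonoidAlgebra.natCast_dvd_coeff
      (quotient_last_modEq_geom_sum hp hreg hx hG j) (r : ZMod (p ^ (b + 1)))
    rwa [AddMonoidAlgebra.coeff_sub, Finsupp.sub_apply, coeff_geom_sum_single_one] at h1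
  · intro n hn r
    have h1 := AddMonoidAlgebra.natCast_dvd_coeff
      (quotient_add_period hp hreg hx hG n hn) (r : ZMod (p ^ (b + 1)))
    rwa [AddMonoidAlgebra.coeff_sub, Finsupp.sub_apply] at h1

theorem altBinomSum_succ (m n : ℕ) (r : ℤ) :
    altBinomSum m (n + 1) r = altBinomSum m n r - altBinomSum m n (r - 1) := by
  rw [altBinomSum_eq_coeff, altBinomSum_eq_coeff, altBinomSum_eq_coeff, pow_succ', sub_mul, one_mul,
    AddMonoidAlgebra.coeff_sub, Finsupp.sub_apply]
  rw [AddMonoidAlgebra.coeff_single_mul_apply, one_mul]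
  congr 2
  push_cast
  ring

/-! ### The exponent, the quotient and the shift -/

theorem weismanExponent_eq {p : ℕ} (hp : p.Prime) (b m : ℕ) (hm : p ^ b ≤ m) :
    weismanExponent p (b + 1) m = ((m - p ^ b) / (p ^ b * (p - 1)) : ℕ) := by
  rw [weismanExponent, Nat.totient_prime_pow_succ hp, Nat.add_sub_cancel, ← Nat.cast_pow,
    ← Nat.cast_sub hm, Rat.floor_natCast_div_natCast,
    Int.natCast_div]

theorem weismanExponent_of_lt {p : ℕ} (hp : p.Prime) (b m : ℕ) (hm : m < p ^ b) :
    weismanExponent p (b + 1) m = -1 := by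
  rw [weismanExponent, Nat.totient_prime_pow_succ hp, Nat.add_sub_cancel, Int.floor_eq_iff]
  have hw : 0 < p ^ b * (p - 1) := Nat.mul_pos (pow_pos hp.pos _) (Nat.sub_pos_of_lt hp.one_lt)
  have hw' : (0 : ℚ) < ((p ^ b * (p - 1) : ℕ) : ℚ) := by exact_mod_cast hw
  have h1 : p ^ b ≤ p ^ b * (p - 1) := Nat.le_mul_of_pos_right _ (Nat.sub_pos_of_lt hp.one_lt)
  have h2 : ((p : ℚ) ^ b) ≤ ((p ^ b * (p - 1) : ℕ) : ℚ) := by exact_mod_cast h1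
  have h3 : (m : ℚ) < (p : ℚ) ^ b := by exact_mod_cast hm
  constructor
  · rw [le_div_iff₀ hw']
    push_cast at h2 ⊢
    linarith [(Nat.cast_nonneg m : (0 : ℚ) ≤ m)]
  · rw [div_lt_iff₀ hw']
    push_cast at h2 ⊢
    linarith

theorem fleckQuotient_eq {p : ℕ} (hp : p.Prime) {b m : ℕ} (hm : p ^ b ≤ m) {r z : ℤ}
    (h : altBinomSum (p ^ (b + 1)) m r = (-(p : ℤ)) ^ ((m - p ^ b) / (p ^ b * (p - 1))) * z) :
    fleckQuotient p (b + 1) m r = z := by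
  have hp0 : (-(p : ℚ)) ≠ 0 := neg_ne_zero.2 (by exact_mod_cast hp.ne_zero)
  rw [fleckQuotient, weismanExponent_eq hp b m hm, h, if_neg (by simpa using hm), add_zero,
    zpow_neg, zpow_natCast]
  push_cast
  rw [← mul_assoc, inv_mul_cancel₀ (pow_ne_zero _ hp0), one_mul]

theorem intCast_modEq_natCast_iff {p : ℕ} {y z : ℤ} :
    (y : ℚ) ≡ (z : ℚ) [PMOD (p : ℚ)] ↔ (p : ℤ) ∣ y - z := by
  rw [AddCommGroup.modEq_comm, AddCommGroup.modEq_iff_zsmul']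
  refine exists_congr fun m => ?_
  rw [zsmul_eq_mul, mul_comm]
  norm_cast

/-- `n + d` is the first argument from `n` on at which all Fleck quotients are `≡ 1`
(see `quotient_last_modEq_geom_sum`). -/
theorem fleckShift_spec {p : ℕ} (hp : p.Prime) (b n : ℕ) (hn : p ^ b ≤ n) :
    fleckShift p (b + 1) n < p ^ b * (p - 1) ∧
      ∃ j, n + fleckShift p (b + 1) n = p ^ (b + 1) - 1 + j * (p ^ b * (p - 1)) := by
  have hw : 0 < p ^ b * (p - 1) := Nat.mul_pos (pow_pos hp.pos _) (Nat.sub_pos_of_lt hp.one_lt)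
  have hpow := prime_pow_succ_eq_add hp b
  have hb : 0 < p ^ b := pow_pos hp.pos _
  rw [fleckShift, Nat.totient_prime_pow_succ hp, Nat.add_sub_cancel]
  generalize p ^ b * (p - 1) = w at *
  have hb' : (p : ℤ) ^ b = ((p ^ b : ℕ) : ℤ) := by push_cast; rfl
  rw [hb']
  generalize p ^ b = q at *
  have hw' : (0 : ℤ) < w := by exact_mod_cast hw
  have h1 := Int.emod_nonneg ((q : ℤ) - 1 - n) hw'.ne'
  have h2 := Int.emod_lt_of_pos ((q : ℤ) - 1 - n) hw'
  have h3 := Int.emod_add_mul_ediv ((q : ℤ) - 1 - n) w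
  generalize ((q : ℤ) - 1 - n) % w = d at *
  generalize ((q : ℤ) - 1 - n) / w = k at *
  lift d to ℕ using h1
  refine ⟨by simpa using h2, ?_⟩
  -- The quotient `k` is negative because `p ^ b - 1 - n` is, which is what makes `j ≥ 0`.
  have hk : k < 0 := by
    by_contra! hk
    have := mul_nonneg hw'.le hk
    omega
  obtain ⟨j, rfl⟩ : ∃ j : ℕ, k = -(j + 1) := ⟨(-k - 1).toNat, by omega⟩
  refine ⟨j, ?_⟩
  rw [hpow]
  zify [show 1 ≤ q + w by omega]
  simp only [Int.toNat_natCast]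
  linarith

/-! ### Descent along backward differences -/

/-- Newton's summation modulo `p`: if each row is the backward difference of the preceding one and
row `d` is constant modulo `p`, then row `0` is determined by the entries at `0` of all rows. -/
theorem dvd_sub_sum_multichoose {p : ℤ} (d : ℕ) : ∀ (f : ℕ → ℤ → ℤ),
    (∀ k < d, ∀ r, f (k + 1) r = f k r - f k (r - 1)) → (∀ r, p ∣ f d r - f d 0) →
    ∀ r, p ∣ f 0 r - ∑ k ∈ Finset.range (d + 1), Ring.multichoose r k * f k 0 := by
  induction d with
  | zero =>
    intro f _ h0 r
    simpa using h0 r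
  | succ d ih =>
    intro f hf h0
    have h1 := ih (fun k => f (k + 1)) (fun k hk => hf (k + 1) (by omega)) h0
    have hstep : ∀ r, p ∣ (f 0 (r + 1)
        - ∑ k ∈ Finset.range (d + 1 + 1), Ring.multichoose (r + 1) k * f k 0)
        - (f 0 r - ∑ k ∈ Finset.range (d + 1 + 1), Ring.multichoose r k * f k 0) := by
      intro r
      have h2 := hf 0 (by omega) (r + 1)
      rw [add_sub_cancel_right] at h2
      convert h1 (r + 1) using 1
      simp only [zero_add] at h2 ⊢
      rw [h2, Finset.sum_range_succ' _ (d + 1), Finset.sum_range_succ' _ (d + 1)]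
      simp only [Ring.multichoose_succ_succ, add_mul, Finset.sum_add_distrib,
        Ring.multichoose_zero_right]
      ring
    intro r
    induction r using Int.induction_on with
    | zero =>
      rw [Finset.sum_range_succ']
      simp [Ring.multichoose_zero_succ]
    | succ i ih => simpa using dvd_add (hstep i) ih
    | pred i ih =>
      have h3 := hstep (-i - 1)
      rw [sub_add_cancel] at h3
      simpa using dvd_sub ih h3

theorem exists_not_dvd_of_backward_difference {p : ℤ} {f : ℕ → ℤ → ℤ} (d : ℕ)
    (hf : ∀ k < d, ∀ r, f (k + 1) r = f k r - f k (r - 1)) (h : ∃ r, ¬ p ∣ f d r) :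
    ∃ r, ¬ p ∣ f 0 r := by
  induction d with
  | zero => exact h
  | succ d ih =>
    apply ih fun k hk => hf k (by omega)
    obtain ⟨r, hr⟩ := h
    by_contra! H
    rw [hf d (by omega)] at hr
    exact hr (dvd_sub (H r) (H (r - 1)))

/-! ### The congruences for generalized Fleck quotients -/

theorem theorem1p4 (p a n : ℕ) (hp : p.Prime) (ha : 1 ≤ a) (hn : p ^ (a - 1) ≤ n) :
    -- the generalized Fleck quotients are integers
    (∀ (m : ℕ) (r : ℤ), ∃ z : ℤ, fleckQuotient p a m r = (z : ℚ)) ∧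
    -- (i)
    (∀ r : ℤ, fleckQuotient p a n r ≡
      ∑ k ∈ Finset.range (fleckShift p a n + 1),
        ((Ring.choose (r + (k : ℤ) - 1) k : ℤ) : ℚ) * fleckQuotient p a (n + k) 0
      [PMOD (p : ℚ)]) ∧
    -- (ii), first part
    (∃ r : ℤ, altBinomSum (p ^ a) n r ≠ 0 ∧
      (padicValInt p (altBinomSum (p ^ a) n r) : ℤ) = weismanExponent p a n ∧
      ¬ fleckQuotient p a n r ≡ 0 [PMOD (p : ℚ)]) ∧
    -- (ii), second part
    (2 * p ^ (a - 1) ≤ n → ∀ r : ℤ,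
      fleckQuotient p a (n + p ^ a * (p - 1)) r ≡ fleckQuotient p a n r [PMOD (p : ℚ)]) := by
  obtain ⟨b, rfl⟩ := Nat.exists_eq_add_of_le' ha
  rw [Nat.add_sub_cancel] at hn ⊢
  have : Fact p.Prime := ⟨hp⟩
  have hp0 : (-(p : ℤ)) ≠ 0 := neg_ne_zero.2 (by exact_mod_cast hp.ne_zero)
  obtain ⟨F, hF, hlast, hper⟩ := exists_fleck_quotient hp b
  have hq : ∀ m, p ^ b ≤ m → ∀ r, fleckQuotient p (b + 1) m r = F m r :=
    fun m hm r => fleckQuotient_eq hp hm (hF m hm r)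
  obtain ⟨hd, j, hj⟩ := fleckShift_spec hp b n hn
  set d := fleckShift p (b + 1) n
  have hone : ∀ r, (p : ℤ) ∣ F (n + d) r - 1 := by
    rw [hj]
    exact hlast j
  -- Before `n + d` the exponent is constant, so Pascal's rule passes to the quotients.
  have hrec : ∀ k < d, ∀ r, F (n + (k + 1)) r = F (n + k) r - F (n + k) (r - 1) := by
    intro k hk r
    have hidx : (n + (k + 1) - p ^ b) / (p ^ b * (p - 1)) = (n + k - p ^ b) / (p ^ b * (p - 1)) := by
      rw [← add_assoc, Nat.sub_add_comm (hn.trans (Nat.le_add_right n k)), Nat.succ_div, if_neg,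
        add_zero]
      intro hdvd
      have h1 : n + d + 1 - p ^ b = (j + 1) * (p ^ b * (p - 1)) := by
        have := prime_pow_succ_eq_add hp b
        have hb : 0 < p ^ b := pow_pos hp.pos _
        rw [add_one_mul]
        omega
      have h2 := Nat.dvd_sub (Dvd.intro_left _ h1.symm) hdvd
      have h3 := Nat.le_of_dvd (by omega) h2
      omega
    have h1 := altBinomSum_succ (p ^ (b + 1)) (n + k) r
    rw [hF _ (by omega), hF _ (by omega), add_assoc, hF _ (by omega), hidx, ← mul_sub] at h1
    exact mul_left_cancel₀ (pow_ne_zero _ hp0) h1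
  refine ⟨fun m r => ?_, fun r => ?_, ?_, fun h2 r => ?_⟩
  · by_cases hm : p ^ b ≤ m
    · exact ⟨F m r, hq m hm r⟩
    · rw [not_le] at hm
      refine ⟨-p * altBinomSum (p ^ (b + 1)) m r + 1, ?_⟩
      rw [fleckQuotient, weismanExponent_of_lt hp b m hm, if_pos (by simpa using hm)]
      simp
  · have h1 := dvd_sub_sum_multichoose d (fun k => F (n + k)) hrec
      (fun r => by simpa using dvd_sub (hone r) (hone 0)) r
    rw [← intCast_modEq_natCast_iff] at h1
    have h2 : ∑ k ∈ Finset.range (d + 1), ((Ring.choose (r + (k : ℤ) - 1) k : ℤ) : ℚ)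
          * fleckQuotient p (b + 1) (n + k) 0
        = ((∑ k ∈ Finset.range (d + 1), Ring.multichoose r k * F (n + k) 0 : ℤ) : ℚ) := by
      push_cast
      refine Finset.sum_congr rfl fun k _ => ?_
      rw [hq _ (hn.trans (Nat.le_add_right n k)), Ring.multichoose_eq]
    rw [hq n hn, h2]
    exact h1
  · obtain ⟨r, hr⟩ := exists_not_dvd_of_backward_difference (p := p) (f := fun k => F (n + k)) d hrec
      ⟨0, fun h => hp.one_lt.ne' (by simpa using Int.isUnit_iff.1 (isUnit_of_dvd_one
        ((dvd_sub_right h).1 (hone 0))))⟩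
    rw [add_zero] at hr
    have hr0 : F n r ≠ 0 := fun h => hr (h ▸ dvd_zero _)
    refine ⟨r, ?_, ?_, ?_⟩
    · rw [hF n hn]
      exact mul_ne_zero (pow_ne_zero _ hp0) hr0
    · rw [hF n hn, weismanExponent_eq hp b n hn, padicValInt.mul (pow_ne_zero _ hp0) hr0,
        padicValInt.eq_zero_of_not_dvd hr, add_zero, padicValInt, Int.natAbs_pow, Int.natAbs_neg,
        Int.natAbs_natCast, padicValNat.prime_pow]
    · rw [hq n hn, ← Int.cast_zero (R := ℚ), intCast_modEq_natCast_iff, sub_zero]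
      exact hr
  · rw [hq _ (by omega), hq n hn, intCast_modEq_natCast_iff]
    exact hper n h2 r
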